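/- An operator system is a complex vector space $X$ with a distinguished element $1_X$ and norms on $M_n(X)$, $n\in\mathbb{N}$, for which there are a Hilbert space $H$ and a linear complete isometry of $X$ onto a norm-closed self-adjoint subspace of $B(H)$ mapping $1_X$ to the identity operator. An operator system $Y$ contains $X$ via an embedding, i.e. a unital linear complete isometry (equivalently, a unital complete order embedding) $X\to Y$. Terms in the language of operator systems are the matrix-valued expressions built from variables and the constant $1$ by sums and by products $\alpha\cdot t\cdot\beta$ with scalar matrices $\alpha,\beta$; quantifier-free formulas are built from the matrix norms of terms by applying continuous functions $\mathbb{R}^k\to\mathbb{R}$ as connectives. An operator system $X$ is existentially closed if, for every operator system $Y$ containing $X$, every quantifier-free formula $\varphi(\vec{x},y)$ and every tuple $\vec{a}$ of elements of $X$, $$\inf_{b\in Y,\ \|b\|\le 1}\varphi(\vec{a},b)=\inf_{b\in X,\ \|b\|\le 1}\varphi(\vec{a},b).$$ Theorem. No nonzero unital C*-algebra $A$, regarded as an operator system with its own unit and its C*-norms on the matrix algebras $M_n(A)$, is existentially closed as an operator system. -/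

import Mathlib

open scoped ComplexOrder InnerProductSpace

universe u


/-- A nonzero positive element is detected by a positive functional. -/
theorem exists_positive_functional_ne_zero {A : Type*} [CStarAlgebra A] [PartialOrder A]
    [StarOrderedRing A] (b : A) (hb : 0 ≤ b) (hb0 : b ≠ 0) : ∃ f : A →ₚ[ℂ] ℂ, f b ≠ 0 := by
  have hmem : -b ∉ {a : A | 0 ≤ a} := by
    intro h
    exact hb0 (le_antisymm (neg_nonneg.mp h) hb)
  have hconv : Convex ℝ {a : A | 0 ≤ a} := by
    intro x hx y hy s t hs ht _
    exact add_nonneg (smul_nonneg hs hx) (smul_nonneg ht hy)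
  obtain ⟨g, r, hr, hg⟩ :=
    geometric_hahn_banach_point_closed hconv CStarAlgebra.isClosed_nonneg hmem
  have hr0 : r < 0 := by simpa using hg 0 (le_refl (0 : A))
  have hgpos : ∀ a : A, 0 ≤ a → 0 ≤ g a := by
    intro a ha
    by_contra! hneg
    have h := hg ((r / g a) • a) (smul_nonneg (div_nonneg_of_nonpos hr0.le hneg.le) ha)
    rw [map_smul, smul_eq_mul, div_mul_cancel₀ _ hneg.ne] at h
    exact lt_irrefl _ h
  have hgb : 0 < g b := by
    rw [map_neg] at hr
    linarith
  let h : Module.Dual ℝ A :=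
    (g : A →ₗ[ℝ] ℝ) ∘ₗ (selfAdjoint.submodule ℝ A).subtype ∘ₗ realPart
  have hdef : ∀ a, h a = g (realPart a : A) := fun a => rfl
  have hF : ∀ a : A, 0 ≤ a → h.extendRCLike (𝕜 := ℂ) a = (g a : ℂ) := by
    intro a ha
    have hsa : IsSelfAdjoint a := .of_nonneg ha
    rw [Module.Dual.extendRCLike_apply, hdef, hdef, hsa.coe_realPart]
    simp [realPart_I_smul, hsa.imaginaryPart]
  refine ⟨PositiveLinearMap.mk₀ (h.extendRCLike (𝕜 := ℂ)) fun a ha => ?_, ?_⟩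
  · rw [hF a ha]
    exact_mod_cast hgpos a ha
  · change h.extendRCLike (𝕜 := ℂ) b ≠ 0
    rw [hF b hb]
    exact_mod_cast hgb.ne'

/-- The diagonal operator on a Hilbert sum given by a uniformly bounded family of operators. -/
noncomputable def hilbertSumDiag {ι : Type*} {H : ι → Type*} [∀ i, NormedAddCommGroup (H i)]
    [∀ i, InnerProductSpace ℂ (H i)] (T : ∀ i, H i →L[ℂ] H i) (C : ℝ) (hC : ∀ i, ‖T i‖ ≤ C) :
    lp H 2 →L[ℂ] lp H 2 :=
  have key : ∀ (v : lp H 2) (i : ι), ‖T i (v i)‖ ≤ ‖((C : ℂ) • v) i‖ := fun v i => by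
    rw [lp.coeFn_smul, Pi.smul_apply, norm_smul, Complex.norm_real]
    exact ((T i).le_opNorm _).trans
      (mul_le_mul_of_nonneg_right ((hC i).trans (le_abs_self C)) (norm_nonneg _))
  LinearMap.mkContinuous
    { toFun := fun v => ⟨fun i => T i (v i), (lp.memℓp ((C : ℂ) • v)).mono' (key v)⟩
      map_add' := fun v w => by
        ext i
        exact map_add (T i) (v i) (w i)
      map_smul' := fun c v => by
        ext i
        exact map_smul (T i) c (v i) }
    |C| (fun v => by
      refine (lp.norm_mono (y := (C : ℂ) • v) (by norm_num) (key v)).trans ?_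
      rw [norm_smul, Complex.norm_real, Real.norm_eq_abs])

theorem hilbertSumDiag_apply {ι : Type*} {H : ι → Type*} [∀ i, NormedAddCommGroup (H i)]
    [∀ i, InnerProductSpace ℂ (H i)] (T : ∀ i, H i →L[ℂ] H i) (C : ℝ) (hC : ∀ i, ‖T i‖ ≤ C)
    (v : lp H 2) (i : ι) : hilbertSumDiag T C hC v i = T i (v i) := rfl

/-- Every unital C*-algebra has a faithful unital representation on a Hilbert space. -/
theorem exists_faithful_representation (A : Type*) [CStarAlgebra A] [PartialOrder A]
    [StarOrderedRing A] :
    ∃ π : A →⋆ₐ[ℂ] (lp (fun f : A →ₚ[ℂ] ℂ => f.GNS) 2 →L[ℂ]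
      lp (fun f : A →ₚ[ℂ] ℂ => f.GNS) 2), Function.Injective π := by
  have hb : ∀ (a : A) (f : A →ₚ[ℂ] ℂ), ‖f.gnsStarAlgHom a‖ ≤ ‖a‖ := fun a f =>
    NonUnitalStarAlgHom.norm_apply_le f.gnsStarAlgHom a
  let D : A → (lp (fun f : A →ₚ[ℂ] ℂ => f.GNS) 2 →L[ℂ] lp (fun f : A →ₚ[ℂ] ℂ => f.GNS) 2) :=
    fun a => hilbertSumDiag (fun f : A →ₚ[ℂ] ℂ => f.gnsStarAlgHom a) ‖a‖ (hb a)
  have hD : ∀ a v f, D a v f = PositiveLinearMap.gnsStarAlgHom f a (v f) := fun a v f => rfl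
  have h1 : D 1 = 1 := by
    ext v f
    rw [hD, map_one]
    rfl
  have hsmul : ∀ (c : ℂ) (a : A), D (c • a) = c • D a := by
    intro c a
    ext v f
    rw [hD, map_smul]
    rfl
  let π : A →⋆ₐ[ℂ] (lp (fun f : A →ₚ[ℂ] ℂ => f.GNS) 2 →L[ℂ]
      lp (fun f : A →ₚ[ℂ] ℂ => f.GNS) 2) :=
    { toFun := D
      map_one' := h1
      map_mul' := fun a b => by
        ext v f
        rw [hD, map_mul]
        rfl
      map_zero' := by
        ext v f
        rw [hD, map_zero]
        rfl
      map_add' := fun a b => by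
        ext v f
        rw [hD, map_add]
        rfl
      commutes' := fun c => by
        rw [Algebra.algebraMap_eq_smul_one, hsmul, h1, Algebra.algebraMap_eq_smul_one]
      map_star' := fun a => by
        rw [ContinuousLinearMap.star_eq_adjoint, ContinuousLinearMap.eq_adjoint_iff]
        intro v w
        rw [lp.inner_eq_tsum, lp.inner_eq_tsum]
        refine tsum_congr fun f => ?_
        rw [hD, hD, map_star, ContinuousLinearMap.star_eq_adjoint,
          ContinuousLinearMap.adjoint_inner_left] }
  refine ⟨π, (injective_iff_map_eq_zero π).mpr fun a ha => ?_⟩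
  by_contra hne
  obtain ⟨f, hf⟩ := exists_positive_functional_ne_zero (star a * a) (star_mul_self_nonneg a)
    (by simpa using hne)
  classical
  have h0 : f.gnsStarAlgHom a ((f.toPreGNS 1 : f.PreGNS) : f.GNS) = 0 := by
    have h := congrArg (fun T => T (lp.single 2 f ((f.toPreGNS 1 : f.PreGNS) : f.GNS)) f) ha
    simp only [zero_apply] at h
    change D a _ f = _ at h
    rw [hD, lp.single_apply_self] at h
    exact h
  have h1' : ((f.leftMulMapPreGNS a (f.toPreGNS 1) : f.PreGNS) : f.GNS) = 0 := by
    rw [← PositiveLinearMap.gnsNonUnitalStarAlgHom_apply_coe]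
    exact h0
  have h2 : ‖f.toPreGNS a‖ = 0 := by
    rw [← UniformSpace.Completion.norm_coe, ← norm_zero (E := f.GNS), ← h1']
    simp
  apply hf
  have h3 := f.preGNS_norm_sq (f.toPreGNS a)
  rw [h2, PositiveLinearMap.ofPreGNS_toPreGNS] at h3
  rw [← h3]
  simp

/-- The Gelfand--Naimark theorem for unital C*-algebras. -/
theorem gelfandNaimark (A : Type u) [CStarAlgebra A] :
    ∃ (H : Type u) (_ : NormedAddCommGroup H) (_ : InnerProductSpace ℂ H) (_ : CompleteSpace H)
      (π : A →⋆ₐ[ℂ] (H →L[ℂ] H)), Function.Injective π := by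
  let _ : PartialOrder A := CStarAlgebra.spectralOrder A
  let _ : StarOrderedRing A := CStarAlgebra.spectralOrderedRing A
  obtain ⟨π, hπ⟩ := exists_faithful_representation A
  exact ⟨_, _, _, inferInstance, π, hπ⟩

/-- The norm on `M_n(A)` that makes it a C*-algebra, for a unital C*-algebra `A`. For `A = B(H)`
this is the norm of operators on the `n`-fold Hilbert sum of `H`. The order below is the canonical
order of `A`; it is only needed by the Mathlib definition of the norm. -/
noncomputable def cstarMatrixNorm (A : Type*) [CStarAlgebra A] {n : ℕ}
    (x : Matrix (Fin n) (Fin n) A) : ℝ :=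
  letI : PartialOrder A := CStarAlgebra.spectralOrder A
  letI : StarOrderedRing A := CStarAlgebra.spectralOrderedRing A
  ‖CStarMatrix.ofMatrix x‖

theorem cstarMatrixNorm_map {A B : Type*} [CStarAlgebra A] [CStarAlgebra B] (π : A →⋆ₐ[ℂ] B)
    (hπ : Function.Injective π) {n : ℕ} (x : Matrix (Fin n) (Fin n) A) :
    cstarMatrixNorm B (x.map π) = cstarMatrixNorm A x := by
  let _ : PartialOrder A := CStarAlgebra.spectralOrder A
  let _ : StarOrderedRing A := CStarAlgebra.spectralOrderedRing A
  let _ : PartialOrder B := CStarAlgebra.spectralOrder B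
  let _ : StarOrderedRing B := CStarAlgebra.spectralOrderedRing B
  exact NonUnitalStarAlgHom.norm_map (CStarMatrix.mapₙₐ (n := Fin n) (π : A →⋆ₙₐ[ℂ] B))
    (CStarMatrix.map_injective hπ) (CStarMatrix.ofMatrix x)

/-- An operator system: a complex vector space with a distinguished element and matrix norms that
admits a linear complete isometry onto a closed self-adjoint subspace of some `B(H)` mapping the
distinguished element to the identity operator. -/
structure OperatorSystem : Type (u + 1) where
  carrier : Type u
  [addCommGroup : AddCommGroup carrier]
  [module : Module ℂ carrier]
  unit : carrier
  matrixNorm : ∀ {n : ℕ}, Matrix (Fin n) (Fin n) carrier → ℝ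
  exists_representation :
    ∃ (H : Type u) (_ : NormedAddCommGroup H) (_ : InnerProductSpace ℂ H) (_ : CompleteSpace H)
      (φ : carrier →ₗ[ℂ] (H →L[ℂ] H)),
      (∀ (n : ℕ) (x : Matrix (Fin n) (Fin n) carrier),
        cstarMatrixNorm (H →L[ℂ] H) (x.map φ) = matrixNorm x) ∧
      φ unit = 1 ∧
      IsClosed (Set.range φ) ∧
      ∀ T ∈ Set.range φ, star T ∈ Set.range φ

namespace OperatorSystem

attribute [instance] addCommGroup module

/-- The closed unit ball of an operator system. -/
def ball (X : OperatorSystem.{u}) : Set X.carrier :=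
  {x | X.matrixNorm (Matrix.of fun _ _ : Fin 1 => x) ≤ 1}

/-- Unital linear complete isometries, that is, complete order embeddings; up to the identification
of `X` with its image, these are the ways in which `Y` contains `X`. -/
structure Embedding (X Y : OperatorSystem.{u}) where
  toLinearMap : X.carrier →ₗ[ℂ] Y.carrier
  map_unit : toLinearMap X.unit = Y.unit
  matrixNorm_map : ∀ (n : ℕ) (x : Matrix (Fin n) (Fin n) X.carrier),
    Y.matrixNorm (x.map toLinearMap) = X.matrixNorm x

/-- Terms, with variables indexed by `V`, of sort `M_n(X)` in the language of operator systems
(operator spaces with a constant for the unit). The constructor `mul` is the two-sided product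
`α.t.β` with rectangular scalar matrices; it covers scalar multiples, corners and amplifications. A
rectangular matrix over `X` is represented by the square matrix obtained by adding zero rows or
columns, which has the same norm. -/
inductive Term (V : Type) : ℕ → Type
  | var (v : V) : Term V 1
  | unit : Term V 1
  | add {n : ℕ} (s t : Term V n) : Term V n
  | mul {m n : ℕ} (α : Matrix (Fin m) (Fin n) ℂ) (t : Term V n) (β : Matrix (Fin n) (Fin m) ℂ) :
      Term V m

/-- Quantifier-free formulas of continuous logic: the atomic ones are the matrix norms of terms, and
the connectives are the continuous functions `ℝ^k → ℝ`. -/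
inductive QFFormula (V : Type) : Type
  | norm {n : ℕ} (t : Term V n) : QFFormula V
  | connective {k : ℕ} (f : C(Fin k → ℝ, ℝ)) (φ : Fin k → QFFormula V) : QFFormula V

/-- The value of a term in an operator system. -/
def Term.eval (X : OperatorSystem.{u}) {V : Type} (a : V → X.carrier) :
    {n : ℕ} → Term V n → Matrix (Fin n) (Fin n) X.carrier
  | _, .var v => Matrix.of fun _ _ => a v
  | _, .unit => Matrix.of fun _ _ => X.unit
  | _, .add s t => s.eval X a + t.eval X a
  | _, .mul α t β => Matrix.of fun i j => ∑ k, ∑ l, (α i k * β l j) • t.eval X a k l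

/-- The value of a quantifier-free formula in an operator system. -/
def QFFormula.eval (X : OperatorSystem.{u}) {V : Type} (a : V → X.carrier) : QFFormula V → ℝ
  | .norm t => X.matrixNorm (t.eval X a)
  | .connective f φ => f fun i => (φ i).eval X a

/-- `X` is existentially closed: for every operator system `Y` containing `X`, every quantifier-free
formula `φ(x₁, …, x_k, y)` and all `a₁, …, a_k` in `X`, the infimum of `φ(a, b)` over the unit ball
of `Y` equals the infimum over the unit ball of `X`. The variable `y` has index `0`. (The values of
`φ(a, ·)` on a unit ball are bounded, so these are infima of nonempty bounded sets of reals.) -/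
def IsExistentiallyClosed (X : OperatorSystem.{u}) : Prop :=
  ∀ (Y : OperatorSystem.{u}) (ι : X.Embedding Y) (k : ℕ) (φ : QFFormula (Fin (k + 1)))
    (a : Fin k → X.carrier),
    ⨅ b : Y.ball, φ.eval Y (Matrix.vecCons b.1 fun i => ι.toLinearMap (a i)) =
      ⨅ b : X.ball, φ.eval X (Matrix.vecCons b.1 a)

/-- A unital C*-algebra as an operator system, with its own unit and its C*-norms on matrices. -/
noncomputable abbrev ofCStarAlgebra (A : Type u) [CStarAlgebra A] : OperatorSystem.{u} where
  carrier := A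
  unit := 1
  matrixNorm := cstarMatrixNorm A
  exists_representation := by
    obtain ⟨H, _, _, _, π, hπ⟩ := gelfandNaimark A
    refine ⟨H, inferInstance, inferInstance, inferInstance, (π : A →ₐ[ℂ] (H →L[ℂ] H)).toLinearMap,
      fun n x => cstarMatrixNorm_map π hπ x, map_one π,
      (NonUnitalStarAlgHom.isometry π hπ).isClosedEmbedding.isClosed_range, ?_⟩
    rintro _ ⟨a, rfl⟩
    exact ⟨star a, map_star π a⟩

end OperatorSystem

/-! The matrix norms of a C*-algebra recognise unitaries: if `u` is unitary, the row `(u, b)` has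
squared norm `1 + ‖b‖²` for every `b`. An embedding of operator systems need not be multiplicative,
so it can destroy this property. Suppose `A` has a non-scalar unitary `u`. Represent `A` faithfully
by `π`, and let `τ` be a unitary conjugate of `π` with `τ u ≠ π u`. The map `a ↦ (a, (π a + τ a) /
2)` is a unital complete isometry into `A × B(H)`. With `s` and `d` half the sum and half the
difference of `π u` and `τ u`, one has `s s* + d d* = 1`, so at `(0, d)` the squared row norm minus
`‖d‖²` is `1 - ‖d‖² < 1`. Otherwise `A` is `ℂ`, because unitaries span. There the parallelogram law
bounds `‖1 + y‖² + ‖1 - y‖²` by 4 on the unit ball, but in `ℂ × ℂ` the value 8 occurs at `(1, -1)`.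
-/

/-! ### Matrix norms over a C*-algebra -/

section MatrixNorm

variable {A B : Type*} [CStarAlgebra A] [CStarAlgebra B]

theorem cstarMatrixNorm_add_le {n : ℕ} (x y : Matrix (Fin n) (Fin n) A) :
    cstarMatrixNorm A (x + y) ≤ cstarMatrixNorm A x + cstarMatrixNorm A y :=
  letI : PartialOrder A := CStarAlgebra.spectralOrder A
  letI : StarOrderedRing A := CStarAlgebra.spectralOrderedRing A
  norm_add_le (CStarMatrix.ofMatrix x) (CStarMatrix.ofMatrix y)

theorem cstarMatrixNorm_smul {n : ℕ} (c : ℂ) (x : Matrix (Fin n) (Fin n) A) :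
    cstarMatrixNorm A (c • x) = ‖c‖ * cstarMatrixNorm A x :=
  letI : PartialOrder A := CStarAlgebra.spectralOrder A
  letI : StarOrderedRing A := CStarAlgebra.spectralOrderedRing A
  norm_smul c (CStarMatrix.ofMatrix x)

theorem cstarMatrixNorm_map_le (π : A →⋆ₐ[ℂ] B) {n : ℕ} (x : Matrix (Fin n) (Fin n) A) :
    cstarMatrixNorm B (x.map π) ≤ cstarMatrixNorm A x := by
  let _ : PartialOrder A := CStarAlgebra.spectralOrder A
  let _ : StarOrderedRing A := CStarAlgebra.spectralOrderedRing A
  let _ : PartialOrder B := CStarAlgebra.spectralOrder B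
  let _ : StarOrderedRing B := CStarAlgebra.spectralOrderedRing B
  exact NonUnitalStarAlgHom.norm_apply_le
    (CStarMatrix.mapₙₐ (n := Fin n) (π : A →⋆ₙₐ[ℂ] B)) (CStarMatrix.ofMatrix x)

/-- The embedding of an algebra as a diagonal corner of a matrix algebra over it. -/
def cornerHom (A : Type*) [CStarAlgebra A] {n : ℕ} (i : Fin n) :
    A →⋆ₙₐ[ℂ] CStarMatrix (Fin n) (Fin n) A where
  toFun a := CStarMatrix.ofMatrix (Matrix.single i i a)
  map_smul' c a := congrArg CStarMatrix.ofMatrix (Matrix.smul_single c i i a).symm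
  map_zero' := congrArg CStarMatrix.ofMatrix (Matrix.single_zero i i)
  map_add' a b := congrArg CStarMatrix.ofMatrix (Matrix.single_add i i a b)
  map_mul' a b := congrArg CStarMatrix.ofMatrix (Matrix.single_mul_single_same a i i i b).symm
  map_star' a := by
    classical exact congrArg CStarMatrix.ofMatrix (Matrix.conjTranspose_single i i a).symm

theorem cstarMatrixNorm_single {n : ℕ} (i : Fin n) (a : A) :
    cstarMatrixNorm A (Matrix.single i i a) = ‖a‖ := by
  let _ : PartialOrder A := CStarAlgebra.spectralOrder A
  let _ : StarOrderedRing A := CStarAlgebra.spectralOrderedRing A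
  exact NonUnitalStarAlgHom.norm_map (cornerHom A i) (fun a b h => by
    have h' : Matrix.single i i a = Matrix.single i i b := h
    simpa using congrFun (congrFun h' i) i) a

theorem cstarMatrixNorm_fin_one (a : A) :
    cstarMatrixNorm A (Matrix.of fun _ _ : Fin 1 => a) = ‖a‖ := by
  rw [← cstarMatrixNorm_single (0 : Fin 1) a]
  congr 1
  ext i j
  simp [Subsingleton.elim i 0, Subsingleton.elim j 0]

theorem cstarMatrixNorm_sq {n : ℕ} (x : Matrix (Fin n) (Fin n) A) :
    cstarMatrixNorm A x ^ 2 = cstarMatrixNorm A (x * x.conjTranspose) := by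
  let _ : PartialOrder A := CStarAlgebra.spectralOrder A
  let _ : StarOrderedRing A := CStarAlgebra.spectralOrderedRing A
  rw [sq]
  exact (CStarRing.norm_self_mul_star (x := CStarMatrix.ofMatrix x)).symm

/-- The norm of the row with entries `a` and `b`. -/
theorem cstarMatrixNorm_row_sq (a b : A) :
    cstarMatrixNorm A !![a, b; 0, 0] ^ 2 = ‖a * star a + b * star b‖ := by
  -- The zero second row makes `x x*` vanish outside its `(0, 0)` entry.
  rw [cstarMatrixNorm_sq, ← cstarMatrixNorm_single (0 : Fin 2)]
  congr 1
  ext i j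
  fin_cases i <;> fin_cases j <;> simp [Matrix.mul_apply, Fin.sum_univ_two]

end MatrixNorm

/-! ### Row norms of unitaries and commutation with unitaries -/

/-- For positive `h`, the order characterisation of the norm turns `1 + h ≤ ‖1 + h‖` into `h ≤ ‖1 +
h‖ - 1`, hence `‖h‖ ≤ ‖1 + h‖ - 1`; the triangle inequality gives the converse. -/
theorem CStarAlgebra.norm_one_add_mul_star {A : Type*} [CStarAlgebra A] [Nontrivial A] (b : A) :
    ‖1 + b * star b‖ = 1 + ‖b‖ ^ 2 := by
  let _ : PartialOrder A := CStarAlgebra.spectralOrder A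
  let _ : StarOrderedRing A := CStarAlgebra.spectralOrderedRing A
  have hb : 0 ≤ b * star b := mul_star_self_nonneg b
  have h1 : (1 : A) ≤ 1 + b * star b := le_add_of_nonneg_right hb
  have h0 : (0 : A) ≤ 1 + b * star b := zero_le_one.trans h1
  have hn : 1 ≤ ‖1 + b * star b‖ := by
    simpa using CStarAlgebra.norm_le_norm_of_nonneg_of_le zero_le_one h1
  have hle := (CStarAlgebra.norm_le_iff_le_algebraMap _ (norm_nonneg _) h0).1 le_rfl
  have hle' : b * star b ≤ algebraMap ℝ A (‖1 + b * star b‖ - 1) := by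
    rw [map_sub, map_one]
    exact le_sub_iff_add_le'.2 hle
  have h := (CStarAlgebra.norm_le_iff_le_algebraMap _ (sub_nonneg.2 hn) hb).2 hle'
  have h2 : ‖b * star b‖ = ‖b‖ ^ 2 := by rw [CStarRing.norm_self_mul_star, sq]
  refine le_antisymm ((norm_add_le _ _).trans (by rw [norm_one, h2])) ?_
  rw [← h2]
  linarith

/-- An operator that is not scalar fails to commute with some unitary. -/
theorem exists_conjStarAlgEquiv_ne {H : Type*} [NormedAddCommGroup H] [InnerProductSpace ℂ H]
    [CompleteSpace H] (T : H →L[ℂ] H) (hT : ∀ c : ℂ, T ≠ c • 1) :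
    ∃ w : H ≃ₗᵢ[ℂ] H, w.conjStarAlgEquiv T ≠ T := by
  by_contra! h
  -- If `T` commutes with the reflection in the line of `v`, then `T v` is fixed by it and so lies
  -- on that line. Thus every vector is an eigenvector, which forces `T` to be scalar.
  have key : ∀ v : H, ¬ LinearIndependent ℂ ![v, T v] := by
    intro v hv
    let K := Submodule.span ℂ {v}
    have hvK : v ∈ K := Submodule.mem_span_singleton_self v
    have h1 := congrArg (fun S : H →L[ℂ] H => S v) (h K.reflection)
    simp only [LinearIsometryEquiv.conjStarAlgEquiv_apply_apply, Submodule.reflection_symm,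
      Submodule.reflection_mem_subspace_eq_self hvK] at h1
    obtain ⟨c, hc⟩ := Submodule.mem_span_singleton.1 ((Submodule.reflection_eq_self_iff _).1 h1)
    exact (LinearIndependent.pair_iff' (by simpa using hv.ne_zero 0)).1 hv c hc
  obtain ⟨c, hc⟩ := LinearMap.exists_eq_smul_id_of_forall_notLinearIndependent
    (f := (T : H →ₗ[ℂ] H)) key
  exact hT c (ContinuousLinearMap.coe_injective hc)

/-! ### The non-multiplicative embedding and the criterion -/

namespace OperatorSystem

/-- The identity of `A` paired with the mean of two unital representations of `A`. -/
noncomputable def idProdMean {A B : Type*} [CStarAlgebra A] [CStarAlgebra B] (σ τ : A →⋆ₐ[ℂ] B) :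
    A →ₗ[ℂ] A × B where
  toFun a := (a, (2⁻¹ : ℂ) • (σ a + τ a))
  map_add' a b := Prod.ext rfl (by simp only [map_add, Prod.snd_add, smul_add]; abel)
  map_smul' c a := Prod.ext rfl (by
    simp only [map_smul, Prod.smul_snd, RingHom.id_apply, ← smul_add, smul_comm c])

theorem two_inv_smul_add_self {E : Type*} [AddCommGroup E] [Module ℂ E] (x : E) :
    (2⁻¹ : ℂ) • (x + x) = x := by
  rw [← two_smul ℂ x, smul_smul, inv_mul_cancel₀ two_ne_zero, one_smul]

/-- The map is the mean of two completely contractive *-homomorphisms, and the projection to the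
first coordinate, also completely contractive, inverts it. -/
theorem cstarMatrixNorm_map_idProdMean {A B : Type*} [CStarAlgebra A] [CStarAlgebra B]
    (σ τ : A →⋆ₐ[ℂ] B) {n : ℕ} (x : Matrix (Fin n) (Fin n) A) :
    cstarMatrixNorm (A × B) (x.map (idProdMean σ τ)) = cstarMatrixNorm A x := by
  apply le_antisymm
  · have hx : x.map (idProdMean σ τ) =
        (2⁻¹ : ℂ) • (x.map ((StarAlgHom.id ℂ A).prod σ) + x.map ((StarAlgHom.id ℂ A).prod τ)) := by
      ext1 i j
      exact Prod.ext (two_inv_smul_add_self (x i j)).symm rfl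
    have h1 := cstarMatrixNorm_map_le ((StarAlgHom.id ℂ A).prod σ) x
    have h2 := cstarMatrixNorm_map_le ((StarAlgHom.id ℂ A).prod τ) x
    have h3 := cstarMatrixNorm_add_le (x.map ((StarAlgHom.id ℂ A).prod σ))
      (x.map ((StarAlgHom.id ℂ A).prod τ))
    rw [hx, cstarMatrixNorm_smul, norm_inv, Complex.norm_ofNat]
    linarith
  · have h := cstarMatrixNorm_map_le (StarAlgHom.fst ℂ A B) (x.map (idProdMean σ τ))
    rw [Matrix.map_map] at h
    exact h

/-- The identity paired with the mean of two unital representations, as an embedding of operator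
systems. It is not multiplicative if the representations differ. -/
noncomputable def meanEmbedding {A B : Type u} [CStarAlgebra A] [CStarAlgebra B]
    (σ τ : A →⋆ₐ[ℂ] B) :
    (ofCStarAlgebra A).Embedding (ofCStarAlgebra (A × B)) where
  toLinearMap := idProdMean σ τ
  map_unit := by
    refine Prod.ext rfl ?_
    change (2⁻¹ : ℂ) • (σ 1 + τ 1) = 1
    rw [map_one, map_one, two_inv_smul_add_self]
  matrixNorm_map _ x := cstarMatrixNorm_map_idProdMean σ τ x

/-- An operator system is not existentially closed if a formula that is at least `m` on its unit ball
has a value less than `m` on the unit ball of an extension, where it is bounded below. -/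
theorem not_isExistentiallyClosed_of_lt {X Y : OperatorSystem.{u}} (ι : X.Embedding Y) {k : ℕ}
    (φ : QFFormula (Fin (k + 1))) (a : Fin k → X.carrier) (m M : ℝ) (hX : X.ball.Nonempty)
    (hm : ∀ b ∈ X.ball, m ≤ φ.eval X (Matrix.vecCons b a))
    (hM : ∀ b ∈ Y.ball, M ≤ φ.eval Y (Matrix.vecCons b fun i => ι.toLinearMap (a i)))
    (b : Y.carrier) (hb : b ∈ Y.ball)
    (hlt : φ.eval Y (Matrix.vecCons b fun i => ι.toLinearMap (a i)) < m) :
    ¬ X.IsExistentiallyClosed := by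
  intro h
  have := hX.to_subtype
  have h1 := h Y ι k φ a
  have h2 : m ≤ ⨅ b : X.ball, φ.eval X (Matrix.vecCons b.1 a) := le_ciInf fun b => hm b.1 b.2
  -- The bound `M` matters: a real infimum of a set unbounded below is 0 by convention.
  have h3 := ciInf_le (f := fun b : Y.ball => φ.eval Y (Matrix.vecCons b.1 fun i =>
    ι.toLinearMap (a i))) ⟨M, by rintro _ ⟨b, rfl⟩; exact hM b.1 b.2⟩ ⟨b, hb⟩
  exact absurd (h2.trans (h1.symm.le.trans h3)) (not_le.2 hlt)

/-! ### The two formulas and the two cases -/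

section CStar

variable {A : Type u} [CStarAlgebra A]

theorem mem_ball_ofCStarAlgebra {a : A} : a ∈ (ofCStarAlgebra A).ball ↔ ‖a‖ ≤ 1 := by
  change cstarMatrixNorm A _ ≤ 1 ↔ _
  rw [cstarMatrixNorm_fin_one]

theorem nonempty_ball_ofCStarAlgebra : (ofCStarAlgebra A).ball.Nonempty :=
  ⟨(0 : A), mem_ball_ofCStarAlgebra.2 (by simp)⟩

/-- The row with entries the variables `v` and `w`. -/
def rowTerm {V : Type} (v w : V) : Term V 2 :=
  .add (.mul !![1; 0] (.var v) !![1, 0]) (.mul !![1; 0] (.var w) !![0, 1])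

theorem eval_rowTerm {V : Type} (v w : V) (a : V → A) :
    (rowTerm v w).eval (ofCStarAlgebra A) a = !![a v, a w; 0, 0] := by
  ext i j
  fin_cases i <;> fin_cases j <;> simp [rowTerm, Term.eval]

/-- The formula `‖(x, y)‖² - ‖y‖²`, which is constantly `1` in a C⋆-algebra if `x` is unitary. -/
noncomputable def rowFormula : QFFormula (Fin 2) :=
  .connective (k := 2) ⟨fun r => r 0 ^ 2 - r 1 ^ 2, by fun_prop⟩
    ![.norm (rowTerm 1 0), .norm (.var 0)]

theorem eval_rowFormula (a : Fin 2 → A) :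
    rowFormula.eval (ofCStarAlgebra A) a = ‖a 1 * star (a 1) + a 0 * star (a 0)‖ - ‖a 0‖ ^ 2 := by
  change cstarMatrixNorm A ((rowTerm 1 0).eval (ofCStarAlgebra A) a) ^ 2 -
    cstarMatrixNorm A (Matrix.of fun _ _ : Fin 1 => a 0) ^ 2 = _
  rw [eval_rowTerm, cstarMatrixNorm_row_sq, cstarMatrixNorm_fin_one]

/-- The formula `-(‖1 + y‖² + ‖1 - y‖²)`. -/
noncomputable def parallelogramFormula : QFFormula (Fin 1) :=
  .connective (k := 2) ⟨fun r => -(r 0 ^ 2 + r 1 ^ 2), by fun_prop⟩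
    ![.norm (.add .unit (.var 0)), .norm (.add .unit (.mul !![-1] (.var 0) !![1]))]

theorem eval_parallelogramFormula (a : Fin 1 → A) :
    parallelogramFormula.eval (ofCStarAlgebra A) a = -(‖1 + a 0‖ ^ 2 + ‖1 - a 0‖ ^ 2) := by
  change -(cstarMatrixNorm A (Term.eval (ofCStarAlgebra A) a (.add .unit (.var 0))) ^ 2 +
    cstarMatrixNorm A (Term.eval (ofCStarAlgebra A) a
      (.add .unit (.mul !![-1] (.var 0) !![1]))) ^ 2) = _
  rw [← cstarMatrixNorm_fin_one (1 + a 0), ← cstarMatrixNorm_fin_one (1 - a 0)]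
  congr 5
  ext i j
  simp [Term.eval, sub_eq_add_neg, Subsingleton.elim i 0, Subsingleton.elim j 0]

/-- A C⋆-algebra with a non-scalar unitary is not existentially closed. -/
theorem not_isExistentiallyClosed_of_unitary [Nontrivial A] (u : A) (hu : u ∈ unitary A)
    (hc : ∀ c : ℂ, u ≠ c • 1) : ¬ (ofCStarAlgebra A).IsExistentiallyClosed := by
  obtain ⟨H, _, _, _, π, hπ⟩ := gelfandNaimark A
  obtain ⟨w, hw⟩ := exists_conjStarAlgEquiv_ne (π u) fun c h => hc c (hπ (by
    rw [h, map_smul, map_one]))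
  let τ : A →⋆ₐ[ℂ] (H →L[ℂ] H) := StarAlgHom.comp (StarAlgHomClass.toStarAlgHom w.conjStarAlgEquiv) π
  have hne : τ u ≠ π u := hw
  have hp : π u * star (π u) = 1 := by
    rw [← map_star, ← map_mul, Unitary.mul_star_self_of_mem hu, map_one]
  have ht : τ u * star (τ u) = 1 := by
    rw [← map_star, ← map_mul, Unitary.mul_star_self_of_mem hu, map_one]
  set p := π u
  set t := τ u
  let d : H →L[ℂ] H := (2⁻¹ : ℂ) • (p - t)
  have hd : d ≠ 0 := smul_ne_zero (by norm_num) (sub_ne_zero.2 hne.symm)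
  -- Using only `‖1‖ ≤ 1` avoids having to show that `H` is nontrivial.
  have hnp : ‖p‖ ≤ 1 := by
    have := CStarRing.norm_self_mul_star (x := p)
    rw [hp] at this
    have := this.symm.le.trans ContinuousLinearMap.norm_id_le
    nlinarith
  have hnt : ‖t‖ ≤ 1 := by
    have := CStarRing.norm_self_mul_star (x := t)
    rw [ht] at this
    have := this.symm.le.trans ContinuousLinearMap.norm_id_le
    nlinarith
  have hdn : ‖d‖ ≤ 1 := by
    have := norm_sub_le p t
    rw [norm_smul, norm_inv, Complex.norm_ofNat]
    linarith
  let s : H →L[ℂ] H := (2⁻¹ : ℂ) • (p + t)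
  -- The operator parallelogram identity: `d` fills exactly the defect of `s`, the second coordinate
  -- of the image of `u`.
  have hpar : s * star s + d * star d = 1 := by
    simp only [s, d, star_smul, star_add, star_sub, smul_mul_smul_comm, add_mul, mul_add, sub_mul,
      mul_sub, hp, ht]
    simp only [← smul_add]
    rw [show (1 : H →L[ℂ] H) + t * star p + (p * star t + 1) + (1 - t * star p - (p * star t - 1)) =
      (4 : ℂ) • 1 by rw [Algebra.smul_def, map_ofNat]; noncomm_ring, smul_smul]
    norm_num
  refine not_isExistentiallyClosed_of_lt (meanEmbedding π τ) rowFormula (fun _ => u) 1 (-1)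
    nonempty_ball_ofCStarAlgebra ?_ ?_ ((0, d) : A × (H →L[ℂ] H)) ?_ ?_
  · intro b _
    rw [eval_rowFormula]
    change 1 ≤ ‖u * star u + b * star b‖ - ‖b‖ ^ 2
    rw [Unitary.mul_star_self_of_mem hu, CStarAlgebra.norm_one_add_mul_star]
    simp
  · intro b hb
    rw [eval_rowFormula]
    have h1 := mem_ball_ofCStarAlgebra.1 hb
    change -1 ≤ ‖_‖ - ‖b‖ ^ 2
    have h2 : ‖b‖ ^ 2 ≤ 1 := pow_le_one₀ (norm_nonneg b) h1
    exact (neg_le_neg h2).trans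
      (by simp only [neg_le_sub_iff_le_add, le_add_iff_nonneg_left, norm_nonneg])
  · rw [mem_ball_ofCStarAlgebra, Prod.norm_mk, norm_zero]
    exact max_le zero_le_one hdn
  · rw [eval_rowFormula]
    change ‖((u, s) : A × (H →L[ℂ] H)) * star (u, s) + (0, d) * star (0, d)‖ -
      ‖((0, d) : A × (H →L[ℂ] H))‖ ^ 2 < 1
    have h1 : ((u, s) : A × (H →L[ℂ] H)) * star (u, s) + (0, d) * star (0, d) = 1 := by
      refine Prod.ext ?_ hpar
      change u * star u + 0 * star 0 = 1
      rw [Unitary.mul_star_self_of_mem hu, zero_mul, add_zero]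
    rw [h1, norm_one, Prod.norm_mk, norm_zero, max_eq_right (norm_nonneg d)]
    have := pow_pos (norm_pos_iff.2 hd) 2
    linarith

/-- A C⋆-algebra consisting of scalars is not existentially closed. -/
theorem not_isExistentiallyClosed_of_scalar [Nontrivial A] (hA : ∀ a : A, ∃ c : ℂ, a = c • 1) :
    ¬ (ofCStarAlgebra A).IsExistentiallyClosed := by
  -- With both representations the identity, the embedding is the diagonal `A → A × A`.
  refine not_isExistentiallyClosed_of_lt (meanEmbedding (StarAlgHom.id ℂ A) (StarAlgHom.id ℂ A))
    parallelogramFormula ![] (-4) (-8)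
    nonempty_ball_ofCStarAlgebra ?_ ?_ ((1, -1) : A × A) ?_ ?_
  · intro b hb
    have hb := mem_ball_ofCStarAlgebra.1 hb
    rw [eval_parallelogramFormula]
    change -4 ≤ -(‖1 + b‖ ^ 2 + ‖1 - b‖ ^ 2)
    obtain ⟨c, rfl⟩ := hA b
    have h1 : (1 : A) + c • 1 = (1 + c) • 1 := by rw [add_smul, one_smul]
    have h2 : (1 : A) - c • 1 = (1 - c) • 1 := by rw [sub_smul, one_smul]
    rw [norm_smul, norm_one, mul_one] at hb
    rw [h1, h2, norm_smul, norm_smul, norm_one, mul_one, mul_one]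
    have := parallelogram_law_with_norm ℂ 1 c
    rw [norm_one] at this
    nlinarith [norm_nonneg c]
  · intro b hb
    have hb := mem_ball_ofCStarAlgebra.1 hb
    rw [eval_parallelogramFormula]
    change -8 ≤ -(‖1 + b‖ ^ 2 + ‖1 - b‖ ^ 2)
    have h1 := norm_add_le 1 b
    have h2 := norm_sub_le 1 b
    rw [norm_one] at h1 h2
    nlinarith [norm_nonneg (1 + b), norm_nonneg (1 - b)]
  · rw [mem_ball_ofCStarAlgebra, Prod.norm_mk, norm_neg, norm_one, max_self]
  · rw [eval_parallelogramFormula]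
    change -(‖(1 : A × A) + (1, -1)‖ ^ 2 + ‖(1 : A × A) - (1, -1)‖ ^ 2) < -4
    have h2 : ‖(2 : A)‖ = 2 := by
      rw [← map_ofNat (algebraMap ℂ A), norm_algebraMap', Complex.norm_ofNat]
    have h3 : (1 : A × A) + (1, -1) = (2, 0) := Prod.ext one_add_one_eq_two (add_neg_cancel 1)
    have h4 : (1 : A × A) - (1, -1) = (0, 2) :=
      Prod.ext (sub_self 1) ((sub_neg_eq_add 1 1).trans one_add_one_eq_two)
    rw [h3, h4, Prod.norm_mk, Prod.norm_mk, h2, norm_zero]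
    norm_num

end CStar

end OperatorSystem

theorem mainTheorem10 (A : Type u) [CStarAlgebra A] [Nontrivial A] :
    ¬ (OperatorSystem.ofCStarAlgebra A).IsExistentiallyClosed := by
  by_cases h : ∀ u ∈ unitary A, ∃ c : ℂ, u = c • 1
  · refine OperatorSystem.not_isExistentiallyClosed_of_scalar fun a => ?_
    -- Unitaries span `A`, so scalar unitaries leave only scalars.
    have hle : Submodule.span ℂ (unitary A : Set A) ≤ Submodule.span ℂ {1} :=
      Submodule.span_le.2 fun u hu => by
        obtain ⟨c, hc⟩ := h u hu
        exact Submodule.mem_span_singleton.2 ⟨c, hc.symm⟩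
    have ha : a ∈ Submodule.span ℂ (unitary A : Set A) := by
      rw [CStarAlgebra.span_unitary]
      trivial
    obtain ⟨c, hc⟩ := Submodule.mem_span_singleton.1 (hle ha)
    exact ⟨c, hc.symm⟩
  · push Not at h
    obtain ⟨u, hu, hc⟩ := h
    exact OperatorSystem.not_isExistentiallyClosed_of_unitary u hu hc
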